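/- Let $G$ be a real, connected, compact, semisimple (finite-dimensional, smooth) Lie group with Lie algebra $\mathfrak g$. A smooth vector field $\mathcal X$ on $G$ is called linear if it has a global flow $(\varphi_t)_{t\in\mathbb R}$ and each $\varphi_t$ is an automorphism of the Lie group $G$. Let $\mathcal X$ be a linear vector field on $G$ with flow $\varphi_t$, and let $\mathcal D$ be the associated derivation of $\mathfrak g$, $\mathcal D(Y)=-[\mathcal X,Y]$, where $Y\in\mathfrak g$ is regarded as an invariant vector field on $G$. Suppose that there is $\alpha\in\mathbb R$ such that every complex eigenvalue of $\mathcal D$ belongs to $\{0,\alpha i,-\alpha i\}$. Let $g\in G$ and let $$\Omega=\bigcap_{s\in\mathbb R}\overline{\{\varphi_t(g): t\ge s\}}$$ be the $\omega$-limit set of $g$. If $\Omega$ is nonempty and compact and contains no fixed point of the flow (no $x$ with $\varphi_t(x)=x$ for all $t$), then $\Omega$ is a periodic orbit: there is $x\in G$, not a fixed point, and $T>0$ such that $\varphi_{t+T}(x)=\varphi_t(x)$ for all $t\in\mathbb R$ and $\Omega=\{\varphi_t(x):t\in\mathbb R\}$. -/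

import Mathlib

open scoped Manifold ContDiff TensorProduct

/-- Over `ℝ` the smoothness index used for the Lie algebra of a Lie group is `3 ≤ ∞`, so that the
Lie algebra of a smooth Lie group is available. -/
instance LinearFlow.instLEInfty : ENat.LEInfty (minSmoothness ℝ 3) :=
  ⟨by rw [minSmoothness_of_isRCLikeNormedField]; exact ENat.LEInfty.out⟩

namespace LinearFlow

section Flows

variable {E : Type*} [NormedAddCommGroup E] [NormedSpace ℝ E]
  {H : Type*} [TopologicalSpace H] (I : ModelWithCorners ℝ E H)
  {G : Type*} [TopologicalSpace G] [ChartedSpace H G]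

/-- `φ` is the (globally defined) flow of the vector field `X`: for every `g`, the curve
`t ↦ φ t g` is the integral curve of `X` through `g` at time `0`. -/
structure IsFlowOf (X : (g : G) → TangentSpace I g) (φ : ℝ → G → G) : Prop where
  zero_apply : ∀ g : G, φ 0 g = g
  isMIntegralCurve : ∀ g : G, IsMIntegralCurve (I := I) (fun t : ℝ => φ t g) X

/-- `f` is an automorphism of the Lie group `G`: a group automorphism that is smooth together
with its inverse. -/
def IsLieGroupAutomorphism [Group G] (f : G → G) : Prop :=
  ∃ e : G ≃* G, (∀ g, e g = f g) ∧ ContMDiff I I ∞ (fun g => e g) ∧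
    ContMDiff I I ∞ (fun g => e.symm g)

/-- A smooth vector field on a Lie group is *linear* if it has a global flow consisting of
automorphisms of the Lie group. -/
structure IsLinearVectorField [Group G] [IsManifold I ∞ G]
    (X : (g : G) → TangentSpace I g) : Prop where
  contMDiff : ContMDiff I I.tangent ∞ (fun g => (⟨g, X g⟩ : TangentBundle I G))
  exists_flow : ∃ φ : ℝ → G → G, IsFlowOf I X φ ∧ ∀ t, IsLieGroupAutomorphism I (φ t)

end Flows

section Derivation

variable {E : Type*} [NormedAddCommGroup E] [NormedSpace ℝ E] [CompleteSpace E]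
  {H : Type*} [TopologicalSpace H] (I : ModelWithCorners ℝ E H)
  {G : Type*} [TopologicalSpace G] [ChartedSpace H G] [Group G] [LieGroup I ∞ G]

/-- The map `𝒟 Y = -[X, Y]` of the Lie algebra of `G` associated with a vector field `X`, where an
element `Y` of the Lie algebra is identified with its invariant vector field, and the value of the
bracket at the identity is taken. For a linear vector field `X` this is a derivation. -/
noncomputable def derivationOf (X : (g : G) → TangentSpace I g) :
    GroupLieAlgebra I G →ₗ[ℝ] GroupLieAlgebra I G where
  toFun Y := -VectorField.mlieBracket I X (mulInvariantVectorField Y) (1 : G)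
  map_add' Y Z := by
    rw [mulInvariantVectorField_add, VectorField.mlieBracket_add_right, neg_add]
    · exact mdifferentiableAt_mulInvariantVectorField _
    · exact mdifferentiableAt_mulInvariantVectorField _
  map_smul' c Y := by
    rw [mulInvariantVectorField_smul, VectorField.mlieBracket_const_smul_right, RingHom.id_apply,
      smul_neg]
    exact mdifferentiableAt_mulInvariantVectorField _

/-- A Lie group is *semisimple* if its Lie algebra is semisimple. -/
def IsSemisimpleLieGroup (G : Type*) [TopologicalSpace G] [ChartedSpace H G] [Group G]
    [LieGroup I ∞ G] : Prop :=
  LieAlgebra.IsSemisimple ℝ (GroupLieAlgebra I G)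

end Derivation

/-- `μ` is a complex eigenvalue of the real endomorphism `D`, that is, an eigenvalue of the
complexification of `D`. -/
def IsComplexEigenvalue {V : Type*} [AddCommGroup V] [Module ℝ V] (D : V →ₗ[ℝ] V) (μ : ℂ) : Prop :=
  Module.End.HasEigenvalue (LinearMap.baseChange ℂ D : Module.End ℂ (ℂ ⊗[ℝ] V)) μ

section Orbits

variable {M : Type*} (φ : ℝ → M → M)

/-- `x` is a fixed point of the flow `φ`. -/
def IsFixedPoint (x : M) : Prop := ∀ t : ℝ, φ t x = x

/-- `Γ` is a periodic orbit of the flow `φ`: the orbit of a point which is not fixed and which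
returns after some positive time. -/
def IsPeriodicOrbit (Γ : Set M) : Prop :=
  ∃ x : M, ¬ IsFixedPoint φ x ∧ (∃ T : ℝ, 0 < T ∧ Function.Periodic (fun t => φ t x) T) ∧
    Γ = Set.range (fun t : ℝ => φ t x)

end Orbits

end LinearFlow

/-!
Write the linear vector field in the right trivialization, `c g = dR_{g⁻¹} (X g) ∈ 𝔤`. Since the
flow consists of automorphisms, `c` is a cocycle, `c (g * h) = c g + Ad g (c h)`, and averaging over
the compact group makes it a coboundary, `c g = w - Ad g w`. Hence `𝒟 = ad w` and
`φ t g = γ t * g * (γ t)⁻¹`, where `γ` is the one-parameter subgroup of `w`.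

An invariant inner product makes `ad w` skew, hence semisimple over `ℂ`, so the eigenvalue
hypothesis gives `(ad w)³ = -β² ad w` with `β > 0`. The equation `d/dt Ad (γ t) = ad w ∘ Ad (γ t)`
then has only solutions of period `T = 2π / β`, so `Ad (γ T) = 1`. As `G` is connected, `γ T` is
central, `φ T` is the identity, and the `ω`-limit set of `g` is the orbit of `g`.
-/

namespace LinearFlow

open Filter Set Topology

section LinearAlgebra

variable {V : Type*} [AddCommGroup V] [Module ℝ V]

/-- The inner product space structure given by a positive definite symmetric bilinear form. -/
@[reducible] noncomputable def innerCoreOfPosDef (B : LinearMap.BilinForm ℝ V)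
    (hsymm : ∀ u v, B u v = B v u) (hpos : ∀ v, v ≠ 0 → 0 < B v v) :
    InnerProductSpace.Core ℝ V where
  inner u v := B u v
  conj_inner_symm u v := by simp [hsymm u v]
  re_inner_nonneg v := by
    by_cases hv : v = 0
    · simp [hv]
    · simpa using (hpos v hv).le
  add_left u v w := by simp
  smul_left u v r := by simp
  definite v hv := by
    by_contra h
    exact (hpos v h).ne' hv

theorem isComplexEigenvalue_of_apply_apply_eq {D : V →ₗ[ℝ] V} {v : V} {l : ℝ} (hl : l ≠ 0)
    (hv : v ≠ 0) (h : D (D v) = -(l ^ 2) • v) : IsComplexEigenvalue D (l * Complex.I) := by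
  have hne : (1 : ℂ) ⊗ₜ[ℝ] D v + (l * Complex.I) ⊗ₜ[ℝ] v ≠ 0 := by
    intro h0
    have him := congrArg (TensorProduct.lid ℝ V ∘ Complex.imLm.rTensor V) h0
    simp [hl, hv] at him
  refine Module.End.hasEigenvalue_of_hasEigenvector ⟨Module.End.mem_eigenspace_iff.2 ?_, hne⟩
  rw [map_add, LinearMap.baseChange_tmul, LinearMap.baseChange_tmul, h, smul_add,
    TensorProduct.smul_tmul', TensorProduct.smul_tmul', smul_eq_mul, smul_eq_mul, mul_one,
    TensorProduct.tmul_smul, TensorProduct.smul_tmul', add_comm]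
  congr 2
  rw [Complex.real_smul]
  push_cast
  linear_combination ((l : ℂ) ^ 2) * Complex.I_sq.symm

variable [FiniteDimensional ℝ V] {B : LinearMap.BilinForm ℝ V} {S : V →ₗ[ℝ] V}

theorem exists_basis_apply_apply_eq_of_skew (hsymm : ∀ u v, B u v = B v u)
    (hpos : ∀ v, v ≠ 0 → 0 < B v v) (hS : ∀ u v, B (S u) v = -B u (S v)) :
    ∃ (b : Module.Basis (Fin (Module.finrank ℝ V)) ℝ V) (l : Fin (Module.finrank ℝ V) → ℝ),
      ∀ i, S (S (b i)) = -(l i ^ 2) • b i ∧ (l i = 0 → S (b i) = 0) := by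
  let c := innerCoreOfPosDef B hsymm hpos
  let _ : NormedAddCommGroup V := c.toNormedAddCommGroup
  let _ : InnerProductSpace ℝ V := .ofCore c.toCore
  have hskew : ∀ u v, inner ℝ (S u) v = -inner ℝ u (S v) := hS
  have hsq : (S ∘ₗ S).IsSymmetric := fun u v => by
    simp only [LinearMap.comp_apply, hskew, neg_neg]
  let b := hsq.eigenvectorBasis rfl
  have hb (i) : S (S (b i)) = hsq.eigenvalues rfl i • b i := hsq.apply_eigenvectorBasis rfl i
  have heigen (i) : hsq.eigenvalues rfl i = -‖S (b i)‖ ^ 2 := by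
    have h := hskew (S (b i)) (b i)
    rwa [hb, inner_smul_left, real_inner_self_eq_norm_sq, real_inner_self_eq_norm_sq, b.norm_eq_one,
      one_pow, mul_one] at h
  refine ⟨b.toBasis, fun i => ‖S (b i)‖, fun i => ?_⟩
  rw [b.coe_toBasis]
  exact ⟨by rw [hb, heigen], fun h => norm_eq_zero.1 h⟩

theorem exists_cube_eq_neg_sq_smul_of_skew (hsymm : ∀ u v, B u v = B v u)
    (hpos : ∀ v, v ≠ 0 → 0 < B v v) (hS : ∀ u v, B (S u) v = -B u (S v)) {α : ℝ}
    (hα : ∀ μ : ℂ, IsComplexEigenvalue S μ → μ = 0 ∨ μ = α * Complex.I ∨ μ = -(α * Complex.I)) :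
    ∃ β : ℝ, 0 < β ∧ ∀ v, S (S (S v)) = -(β ^ 2) • S v := by
  obtain ⟨b, l, hb⟩ := exists_basis_apply_apply_eq_of_skew hsymm hpos hS
  have hl (i) (hi : l i ≠ 0) : l i ^ 2 = α ^ 2 := by
    have h := hα _ (isComplexEigenvalue_of_apply_apply_eq hi (b.ne_zero i) (hb i).1)
    simp only [mul_eq_zero, Complex.I_ne_zero, or_false, Complex.ofReal_eq_zero, hi, false_or,
      ← neg_mul, mul_left_inj' Complex.I_ne_zero] at h
    exact sq_eq_sq_iff_eq_or_eq_neg.2 (by exact_mod_cast h)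
  suffices h : ∃ β : ℝ, 0 < β ∧ ∀ i, S (S (S (b i))) = -(β ^ 2) • S (b i) by
    obtain ⟨β, hβ, h⟩ := h
    refine ⟨β, hβ, fun v => ?_⟩
    exact LinearMap.congr_fun (b.ext h : S ∘ₗ S ∘ₗ S = -(β ^ 2) • S) v
  refine ⟨if α = 0 then 1 else |α|, by split_ifs <;> positivity, fun i => ?_⟩
  by_cases hi : l i = 0
  · simp [(hb i).2 hi]
  · have hα0 : α ≠ 0 := by rintro rfl; exact hi (by simpa using hl i hi)
    rw [(hb i).1, map_smul, hl i hi, if_neg hα0, sq_abs]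

end LinearAlgebra

section ConstantCoefficients

variable {V : Type*} [NormedAddCommGroup V] [NormedSpace ℝ V]

theorem eq_add_sin_smul_add_cos_smul {A : V →L[ℝ] V} {β : ℝ} (hβ : β ≠ 0)
    (hA : ∀ v, A (A (A v)) = -(β ^ 2) • A v) {f : ℝ → V} (hf : ∀ t, HasDerivAt f (A (f t)) t)
    (t : ℝ) :
    f t = f 0 + (Real.sin (β * t) / β) • A (f 0) +
      ((1 - Real.cos (β * t)) / β ^ 2) • A (A (f 0)) := by
  let h (t : ℝ) : V := f 0 + (Real.sin (β * t) / β) • A (f 0) +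
      ((1 - Real.cos (β * t)) / β ^ 2) • A (A (f 0))
  have hlin (t : ℝ) : HasDerivAt (fun t => β * t) β t := by
    simpa using (hasDerivAt_id t).const_mul β
  have hh (t : ℝ) : HasDerivAt h (A (h t)) t := by
    have hsin := ((hlin t).sin.div_const β).smul_const (A (f 0))
    have hcos := (((hlin t).cos.const_sub 1).div_const (β ^ 2)).smul_const (A (A (f 0)))
    refine ((hsin.const_add (f 0)).add hcos).congr_deriv ?_
    simp only [h, map_add, map_smul, hA, smul_smul]
    match_scalars <;> field_simp
    ring
  exact congrFun (ODE_solution_unique_univ (v := fun _ => A) (s := fun _ => univ) (t₀ := 0)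
    (fun _ => A.lipschitz.lipschitzOnWith) (fun t => ⟨hf t, mem_univ _⟩)
    (fun t => ⟨hh t, mem_univ _⟩) (by simp [h])) t

end ConstantCoefficients

section Representation

open MeasureTheory

variable {G : Type*} [TopologicalSpace G] [Group G] [IsTopologicalGroup G]
  {V : Type*} [NormedAddCommGroup V] [NormedSpace ℝ V] {ρ : G →* V →L[ℝ] V}

theorem continuous_of_cocycle {c : G → V} (hc : ContinuousAt c 1)
    (hmul : ∀ g h, c (g * h) = c g + ρ g (c h)) : Continuous c := by
  refine continuous_iff_continuousAt.2 fun g => ?_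
  have hshift : c = fun x => c g + ρ g (c (g⁻¹ * x)) := by
    ext x
    rw [← hmul, mul_inv_cancel_left]
  rw [hshift]
  refine continuousAt_const.add ((ρ g).continuous.continuousAt.comp
    (ContinuousAt.comp (g := c) ?_ (continuous_const_mul g⁻¹).continuousAt))
  rwa [inv_mul_cancel]

variable [CompactSpace G]

theorem exists_invariant_bilinForm [FiniteDimensional ℝ V] (hρ : ∀ v, Continuous fun g => ρ g v) :
    ∃ B : LinearMap.BilinForm ℝ V, (∀ u v, B u v = B v u) ∧ (∀ v, v ≠ 0 → 0 < B v v) ∧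
      ∀ g u v, B (ρ g u) (ρ g v) = B u v := by
  let _ : MeasurableSpace G := borel G
  have : BorelSpace G := ⟨rfl⟩
  let μ : Measure G := Measure.haar
  let f (u v : V) (g : G) : ℝ := inner ℝ (toEuclidean (ρ g⁻¹ u)) (toEuclidean (ρ g⁻¹ v))
  have hcont (u v : V) : Continuous (f u v) :=
    have h (u : V) : Continuous fun g => toEuclidean (ρ g⁻¹ u) :=
      toEuclidean.continuous.comp ((hρ u).comp continuous_inv)
    (h u).inner (h v)
  have hint (u v : V) : Integrable (f u v) μ :=
    (hcont u v).integrable_of_hasCompactSupport (HasCompactSupport.of_compactSpace _)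
  let B : LinearMap.BilinForm ℝ V := LinearMap.mk₂ ℝ (fun u v => ∫ g, f u v g ∂μ)
    (fun u u' v => by
      simp only [f, map_add, inner_add_left, ← integral_add (hint u v) (hint u' v)])
    (fun c u v => by simp only [f, map_smul, real_inner_smul_left, integral_const_mul, smul_eq_mul])
    (fun u v v' => by
      simp only [f, map_add, inner_add_right, ← integral_add (hint u v) (hint u v')])
    (fun c u v => by
      simp only [f, map_smul, real_inner_smul_right, integral_const_mul, smul_eq_mul])
  refine ⟨B, fun u v => ?_, fun v hv => ?_, fun g u v => ?_⟩
  · change ∫ g, f u v g ∂μ = ∫ g, f v u g ∂μ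
    simp only [f, real_inner_comm]
  · refine (hcont v v).integral_pos_of_hasCompactSupport_nonneg_nonzero
      (HasCompactSupport.of_compactSpace _) (fun g => real_inner_self_nonneg) (x := 1) ?_
    simp [f, hv]
  · change ∫ h, f (ρ g u) (ρ g v) h ∂μ = ∫ h, f u v h ∂μ
    rw [← integral_mul_left_eq_self (f u v) g⁻¹]
    simp only [f, mul_inv_rev, inv_inv, map_mul, mul_apply_eq_comp]

theorem exists_eq_sub_of_cocycle [CompleteSpace V] {c : G → V} (hc : Continuous c)
    (hmul : ∀ g h, c (g * h) = c g + ρ g (c h)) : ∃ w, ∀ g, c g = w - ρ g w := by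
  let _ : MeasurableSpace G := borel G
  have : BorelSpace G := ⟨rfl⟩
  let μ : Measure G := Measure.haarMeasure ⊤
  have : IsProbabilityMeasure μ := ⟨Measure.haarMeasure_self (K₀ := ⊤)⟩
  have hint : Integrable c μ :=
    hc.integrable_of_hasCompactSupport (HasCompactSupport.of_compactSpace _)
  refine ⟨∫ h, c h ∂μ, fun g => ?_⟩
  calc c g = ∫ h, (c (g * h) - ρ g (c h)) ∂μ := by simp [hmul]
    _ = ∫ h, c h ∂μ - ρ g (∫ h, c h ∂μ) := by
      rw [integral_sub (hint.comp_mul_left g) ((ρ g).integrable_comp hint),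
        integral_mul_left_eq_self, ContinuousLinearMap.integral_comp_comm _ hint]

end Representation

section Chart

variable {E : Type*} [NormedAddCommGroup E] [NormedSpace ℝ E]
  {H : Type*} [TopologicalSpace H] {I : ModelWithCorners ℝ E H}
  {M : Type*} [TopologicalSpace M] [ChartedSpace H M]
  {F : Type*} [NormedAddCommGroup F] [NormedSpace ℝ F]

theorem hasMFDerivAt_of_comp_extChartAt_symm [IsManifold I 1 M] {p : M} {x : E}
    (hx : x ∈ (extChartAt I p).target) {f : M → F} {f' : E →L[ℝ] F}
    (hf : HasFDerivAt (f ∘ (extChartAt I p).symm) f' x) :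
    HasMFDerivAt I 𝓘(ℝ, F) f ((extChartAt I p).symm x)
      (f' ∘L mfderiv I 𝓘(ℝ, E) (extChartAt I p) ((extChartAt I p).symm x)) := by
  have hq : (extChartAt I p).symm x ∈ (extChartAt I p).source := (extChartAt I p).map_target hx
  have hchart := (mdifferentiableAt_extChartAt (I := I) (by simpa using hq)).hasMFDerivAt
  rw [← (extChartAt I p).right_inv hx] at hf
  refine (hf.hasMFDerivAt.comp _ hchart).congr_of_eventuallyEq ?_
  filter_upwards [extChartAt_source_mem_nhds' hq] with y hy
  simp only [Function.comp_apply, (extChartAt I p).left_inv hy]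

theorem hasMFDerivAt_extChartAt_self [IsManifold I 1 M] (p : M) :
    HasMFDerivAt I 𝓘(ℝ, E) (extChartAt I p) p (ContinuousLinearMap.id ℝ E) :=
  (mdifferentiableAt_extChartAt (mem_chart_source H p)).hasMFDerivAt.congr_mfderiv
    mfderiv_extChartAt_self

theorem hasMFDerivAt_of_comp_extChartAt_symm_self [IsManifold I 1 M] {p : M} {f : M → F}
    {f' : E →L[ℝ] F} (hf : HasFDerivAt (f ∘ (extChartAt I p).symm) f' (extChartAt I p p)) :
    HasMFDerivAt I 𝓘(ℝ, F) f p f' := by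
  have h := hasMFDerivAt_of_comp_extChartAt_symm (mem_extChartAt_target p) hf
  rw [extChartAt_to_inv, mfderiv_extChartAt_self] at h
  exact h

end Chart

section DerivativeAtOne

variable {E : Type*} [NormedAddCommGroup E] [NormedSpace ℝ E]
  {H : Type*} [TopologicalSpace H] {I : ModelWithCorners ℝ E H}
  {G : Type*} [TopologicalSpace G] [ChartedSpace H G] [Group G] [LieGroup I 1 G]
  {E' : Type*} [NormedAddCommGroup E'] [NormedSpace ℝ E']
  {H' : Type*} [TopologicalSpace H'] {J : ModelWithCorners ℝ E' H'}
  {M : Type*} [TopologicalSpace M] [ChartedSpace H' M]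

theorem hasMFDerivAt_mul_one_one :
    HasMFDerivAt (I.prod I) I (fun p : G × G => p.1 * p.2) (1, 1)
      (ContinuousLinearMap.fst ℝ E E + ContinuousLinearMap.snd ℝ E E) := by
  have hmul : MDifferentiableAt (I.prod I) I (fun p : G × G => p.1 * p.2) (1, 1) :=
    (contMDiff_mul I 1).mdifferentiable one_ne_zero _
  have hleft : (mfderiv I I (fun g : G => g * 1) 1 : E →L[ℝ] E) = ContinuousLinearMap.id ℝ E :=
    ((hasMFDerivAt_id 1).congr_of_eventuallyEq (.of_forall mul_one)).mfderiv
  have hright : (mfderiv I I (fun g : G => 1 * g) 1 : E →L[ℝ] E) = ContinuousLinearMap.id ℝ E :=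
    ((hasMFDerivAt_id 1).congr_of_eventuallyEq (.of_forall one_mul)).mfderiv
  refine hmul.hasMFDerivAt.congr_mfderiv (ContinuousLinearMap.ext fun v => ?_)
  exact (mfderiv_prod_eq_add_apply hmul).trans
    (congrArg₂ (· + ·) (congrArg (· v.1) hleft) (congrArg (· v.2) hright))

variable {p : M} {f h : M → G} {f' h' : E' →L[ℝ] E}

theorem hasMFDerivAt_mul_of_eq_one (hf : HasMFDerivAt J I f p f') (hh : HasMFDerivAt J I h p h')
    (hfp : f p = 1) (hhp : h p = 1) : HasMFDerivAt J I (fun x => f x * h x) p (f' + h') := by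
  have hmul : HasMFDerivAt (I.prod I) I (fun p : G × G => p.1 * p.2) (f p, h p)
      (ContinuousLinearMap.fst ℝ E E + ContinuousLinearMap.snd ℝ E E) := by
    rw [hfp, hhp]
    exact hasMFDerivAt_mul_one_one
  exact hmul.comp p (hf.prodMk hh)

theorem hasMFDerivAt_inv_one :
    HasMFDerivAt I I (fun g : G => g⁻¹) 1 (-ContinuousLinearMap.id ℝ E) := by
  have hinv := ((contMDiff_inv I 1).mdifferentiable one_ne_zero (1 : G)).hasMFDerivAt
  refine hinv.congr_mfderiv (eq_neg_of_add_eq_zero_right ?_)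
  have hprod := hasMFDerivAt_mul_of_eq_one (hasMFDerivAt_id 1) hinv rfl inv_one
  have hconst : HasMFDerivAt I I (fun _ : G => (1 : G)) 1 _ :=
    hprod.congr_of_eventuallyEq (.of_forall fun g => (mul_inv_cancel g).symm)
  have hzero := hasMFDerivAt_unique hconst (hasMFDerivAt_const 1 1)
  exact hzero

theorem hasMFDerivAt_inv_of_eq_one (hf : HasMFDerivAt J I f p f') (hfp : f p = 1) :
    HasMFDerivAt J I (fun x => (f x)⁻¹) p (-f') := by
  have hinv : HasMFDerivAt I I (fun g : G => g⁻¹) (f p) (-ContinuousLinearMap.id ℝ E) := by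
    rw [hfp]
    exact hasMFDerivAt_inv_one
  exact hinv.comp p hf

end DerivativeAtOne

section ChartBoundaryless

variable {E : Type*} [NormedAddCommGroup E] [NormedSpace ℝ E]
  {H : Type*} [TopologicalSpace H] {I : ModelWithCorners ℝ E H}
  {M : Type*} [TopologicalSpace M] [ChartedSpace H M] [BoundarylessManifold I M]
  {E' : Type*} [NormedAddCommGroup E'] [NormedSpace ℝ E']
  {H' : Type*} [TopologicalSpace H'] {J : ModelWithCorners ℝ E' H'}
  {N : Type*} [TopologicalSpace N] [ChartedSpace H' N]

variable (I) in
theorem extChartAt_target_mem_nhds_self (p : M) :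
    (extChartAt I p).target ∈ 𝓝 (extChartAt I p p) :=
  mem_interior_iff_mem_nhds.1 (ModelWithCorners.isInteriorPoint_iff.1
    (BoundarylessManifold.isInteriorPoint' p))

variable (I) in
theorem contMDiffAt_extChartAt_symm_self {n : WithTop ℕ∞} [IsManifold I n M] (p : M) :
    ContMDiffAt 𝓘(ℝ, E) I n (extChartAt I p).symm (extChartAt I p p) :=
  (contMDiffOn_extChartAt_symm p).contMDiffAt (extChartAt_target_mem_nhds_self I p)

theorem contDiffAt_extChartAt_comp_prodMap_symm {n : WithTop ℕ∞} [IsManifold I n M]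
    [IsManifold J n N] {p : M} {q : N} {f : M × M → N} (hf : ContMDiffAt (I.prod I) J n f (p, p))
    (hq : f (p, p) = q) :
    ContDiffAt ℝ n (fun z : E × E => extChartAt J q
      (f ((extChartAt I p).symm z.1, (extChartAt I p).symm z.2)))
      (extChartAt I p p, extChartAt I p p) := by
  rw [← contMDiffAt_iff_contDiffAt]
  have hsymm := contMDiffAt_extChartAt_symm_self I (n := n) p
  have hpair : ContMDiffAt 𝓘(ℝ, E × E) (I.prod I) n
      (fun z : E × E => ((extChartAt I p).symm z.1, (extChartAt I p).symm z.2))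
      (extChartAt I p p, extChartAt I p p) :=
    (hsymm.comp_of_eq contDiffAt_fst.contMDiffAt rfl).prodMk
      (hsymm.comp_of_eq contDiffAt_snd.contMDiffAt rfl)
  refine (contMDiffAt_extChartAt (I := J) (x := q)).comp_of_eq (hf.comp_of_eq hpair ?_) ?_
  · simp only [extChartAt_to_inv]
  · simpa only [Function.comp_apply, extChartAt_to_inv] using hq

end ChartBoundaryless

section Adjoint

variable {E : Type*} [NormedAddCommGroup E] [NormedSpace ℝ E]
  {H : Type*} [TopologicalSpace H] {I : ModelWithCorners ℝ E H}
  {G : Type*} [TopologicalSpace G] [ChartedSpace H G] [Group G] [LieGroup I ∞ G]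

theorem contMDiff_conj (g : G) : ContMDiff I I ∞ fun h : G => g * h * g⁻¹ :=
  (contMDiff_mul_right (a := g⁻¹)).comp (contMDiff_mul_left (a := g))

theorem mdifferentiableAt_conj (g h : G) : MDifferentiableAt I I (fun h => g * h * g⁻¹) h :=
  (contMDiff_conj g).mdifferentiable (by simp) h

variable (I G) in
/-- The adjoint representation of `G` on its tangent space at the identity, which is identified
with the model space `E`. -/
noncomputable def adjointRep : G →* E →L[ℝ] E where
  toFun g := mfderiv I I (fun h => g * h * g⁻¹) 1
  map_one' := by
    have hid : HasMFDerivAt I I (fun h : G => 1 * h * 1⁻¹) 1 (ContinuousLinearMap.id ℝ E) :=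
      (hasMFDerivAt_id 1).congr_of_eventuallyEq (.of_forall fun h => by simp)
    exact hid.mfderiv
  map_mul' g k := by
    have hg : HasMFDerivAt I I (fun h => g * h * g⁻¹) (k * 1 * k⁻¹)
        (mfderiv I I (fun h => g * h * g⁻¹) 1 : E →L[ℝ] E) := by
      rw [mul_one, mul_inv_cancel]
      exact (mdifferentiableAt_conj g 1).hasMFDerivAt
    have hcomp := hg.comp 1 (mdifferentiableAt_conj k 1).hasMFDerivAt
    exact (hcomp.congr_of_eventuallyEq (.of_forall fun h => by simp [mul_assoc])).mfderiv

theorem hasMFDerivAt_conj_of_eq_one {E' : Type*} [NormedAddCommGroup E'] [NormedSpace ℝ E']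
    {H' : Type*} [TopologicalSpace H'] {J : ModelWithCorners ℝ E' H'}
    {M : Type*} [TopologicalSpace M] [ChartedSpace H' M] {p : M} {f : M → G} {f' : E' →L[ℝ] E}
    (g : G) (hf : HasMFDerivAt J I f p f') (hfp : f p = 1) :
    HasMFDerivAt J I (fun x => g * f x * g⁻¹) p (adjointRep I G g ∘L f') := by
  have hconj : HasMFDerivAt I I (fun h => g * h * g⁻¹) (f p) (adjointRep I G g) := by
    rw [hfp]
    exact (mdifferentiableAt_conj g 1).hasMFDerivAt
  exact hconj.comp p hf

theorem adjointRep_eq_fderiv_comp_inr {g : G} {k : E × E → E} {x : E}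
    (hk : DifferentiableAt ℝ k (x, extChartAt I (1 : G) 1))
    (hkg : ∀ y, k (x, y) = extChartAt I (1 : G) (g * (extChartAt I (1 : G)).symm y * g⁻¹)) :
    adjointRep I G g = fderiv ℝ k (x, extChartAt I (1 : G) 1) ∘L ContinuousLinearMap.inr ℝ E E := by
  have hchart : HasMFDerivAt I 𝓘(ℝ, E) (extChartAt I (1 : G)) (g * 1 * g⁻¹)
      (ContinuousLinearMap.id ℝ E) := by
    rw [mul_one, mul_inv_cancel]
    exact hasMFDerivAt_extChartAt_self 1
  have hleft : HasMFDerivAt I 𝓘(ℝ, E) (fun h : G => extChartAt I (1 : G) (g * h * g⁻¹)) 1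
      (adjointRep I G g) := hchart.comp 1 (mdifferentiableAt_conj g 1).hasMFDerivAt
  have hslice : HasFDerivAt (fun y => k (x, y))
      (fderiv ℝ k (x, extChartAt I (1 : G) 1) ∘L ContinuousLinearMap.inr ℝ E E)
      (extChartAt I (1 : G) 1) := hk.hasFDerivAt.comp _ (hasFDerivAt_prodMk_right x _)
  simp only [hkg] at hslice
  exact hasMFDerivAt_unique hleft (hasMFDerivAt_of_comp_extChartAt_symm_self hslice)

theorem mdifferentiableAt_adjointRep_one [BoundarylessManifold I G] :
    MDifferentiableAt I 𝓘(ℝ, E →L[ℝ] E) (adjointRep I G) 1 := by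
  have hconj : ContMDiffAt (I.prod I) I ∞ (fun p : G × G => p.1 * p.2 * p.1⁻¹) (1, 1) :=
    ((contMDiff_fst.mul contMDiff_snd).mul contMDiff_fst.inv).contMDiffAt
  let o : E := extChartAt I (1 : G) 1
  let k (z : E × E) : E := extChartAt I (1 : G) ((extChartAt I (1 : G)).symm z.1 *
    (extChartAt I (1 : G)).symm z.2 * ((extChartAt I (1 : G)).symm z.1)⁻¹)
  have hk : ContDiffAt ℝ ∞ k (o, o) :=
    contDiffAt_extChartAt_comp_prodMap_symm hconj (by simp)
  have hslice : ContDiffAt ℝ 1 (fun x : E => (x, o)) o := contDiffAt_id.prodMk contDiffAt_const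
  have heq : ∀ᶠ x in 𝓝 o, (adjointRep I G ∘ (extChartAt I (1 : G)).symm) x =
      fderiv ℝ k (x, o) ∘L ContinuousLinearMap.inr ℝ E E := by
    have hev : ∀ᶠ z in 𝓝 (o, o), ContDiffAt ℝ 1 k z :=
      (hk.of_le (by simp)).eventually (by norm_num)
    filter_upwards [hslice.continuousAt.eventually hev] with x hx
    exact adjointRep_eq_fderiv_comp_inr (hx.differentiableAt one_ne_zero) fun y => rfl
  have hdiff : DifferentiableAt ℝ
      (fun x => fderiv ℝ k (x, o) ∘L ContinuousLinearMap.inr ℝ E E) o := by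
    have hfderiv : ContDiffAt ℝ 1 (fderiv ℝ k) (o, o) := hk.fderiv_right (by norm_cast)
    have hcomp : ContDiffAt ℝ 1 (fun x => fderiv ℝ k (x, o)) o :=
      hfderiv.comp (f := fun x => (x, o)) o hslice
    exact (hcomp.differentiableAt one_ne_zero).clm_comp (differentiableAt_const _)
  exact (hasMFDerivAt_of_comp_extChartAt_symm_self
    (hdiff.congr_of_eventuallyEq heq).hasFDerivAt).mdifferentiableAt

theorem continuous_adjointRep [BoundarylessManifold I G] : Continuous (adjointRep I G) := by
  have : IsTopologicalGroup G := topologicalGroup_of_lieGroup I ∞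
  exact continuous_of_continuousAt_one _ mdifferentiableAt_adjointRep_one.continuousAt

variable (I G) in
/-- The adjoint representation of the Lie algebra, defined as the derivative at the identity of
the adjoint representation of `G`. -/
noncomputable def adjointDeriv : E →L[ℝ] E →L[ℝ] E :=
  (mfderiv I 𝓘(ℝ, E →L[ℝ] E) (adjointRep I G) 1 : E →L[ℝ] (E →L[ℝ] E))

theorem hasMFDerivAt_adjointRep_one [BoundarylessManifold I G] :
    HasMFDerivAt I 𝓘(ℝ, E →L[ℝ] E) (adjointRep I G) 1
      (adjointDeriv I G : E →L[ℝ] E →L[ℝ] E) :=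
  mdifferentiableAt_adjointRep_one.hasMFDerivAt

end Adjoint

section Velocity

variable {E : Type*} [NormedAddCommGroup E] [NormedSpace ℝ E]
  {H : Type*} [TopologicalSpace H] {I : ModelWithCorners ℝ E H}
  {M : Type*} [TopologicalSpace M] [ChartedSpace H M] {γ : ℝ → M} {t : ℝ} {v w : E}

variable (I) in
/-- The curve `γ` has velocity `v` at time `t`. Tangent vectors are regarded as elements of the
model space `E`, so that velocities at different points can be compared. -/
def HasVelocityAt (γ : ℝ → M) (v : E) (t : ℝ) : Prop :=
  HasMFDerivAt 𝓘(ℝ, ℝ) I γ t ((1 : ℝ →L[ℝ] ℝ).smulRight v)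

theorem isMIntegralCurve_iff_hasVelocityAt {X : (x : M) → TangentSpace I x} :
    IsMIntegralCurve (I := I) γ X ↔ ∀ t, HasVelocityAt I γ (X (γ t)) t :=
  Iff.rfl

theorem hasVelocityAt_iff_hasDerivAt {f : ℝ → E} : HasVelocityAt 𝓘(ℝ, E) f v t ↔ HasDerivAt f v t :=
  hasMFDerivAt_iff_hasFDerivAt

theorem HasVelocityAt.unique (hv : HasVelocityAt I γ v t) (hw : HasVelocityAt I γ w t) : v = w := by
  have h : (1 : ℝ →L[ℝ] ℝ).smulRight v = (1 : ℝ →L[ℝ] ℝ).smulRight w := hasMFDerivAt_unique hv hw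
  simpa using congrArg (fun L : ℝ →L[ℝ] E => L 1) h

theorem hasVelocityAt_const (x : M) (t : ℝ) : HasVelocityAt I (fun _ => x) 0 t := by
  have h : (0 : ℝ →L[ℝ] E) = (1 : ℝ →L[ℝ] ℝ).smulRight 0 := by ext; simp
  exact (hasMFDerivAt_const x t).congr_mfderiv h

variable {E' : Type*} [NormedAddCommGroup E'] [NormedSpace ℝ E']
  {H' : Type*} [TopologicalSpace H'] {J : ModelWithCorners ℝ E' H'}
  {N : Type*} [TopologicalSpace N] [ChartedSpace H' N]

theorem HasVelocityAt.of_comp_mfderiv {f : M → N} {f' : E →L[ℝ] E'} {x : M}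
    (hf : HasMFDerivAt I J f x f') (hx : γ t = x) (hγ : HasVelocityAt I γ v t) :
    HasVelocityAt J (fun s => f (γ s)) (f' v) t := by
  subst hx
  have h : f' ∘L (1 : ℝ →L[ℝ] ℝ).smulRight v = (1 : ℝ →L[ℝ] ℝ).smulRight (f' v) := by ext; simp
  exact (hf.comp t hγ).congr_mfderiv h

theorem HasVelocityAt.comp_add_const (s : ℝ) (hγ : HasVelocityAt I γ v (t + s)) :
    HasVelocityAt I (fun t => γ (t + s)) v t := by
  have hadd : HasMFDerivAt 𝓘(ℝ, ℝ) 𝓘(ℝ, ℝ) (fun t : ℝ => t + s) t (1 : ℝ →L[ℝ] ℝ) :=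
    ((hasFDerivAt_id t).add_const s).hasMFDerivAt
  exact HasMFDerivAt.comp (f := fun t => t + s) t hγ hadd

end Velocity

section OneParameterSubgroup

variable {E : Type*} [NormedAddCommGroup E] [NormedSpace ℝ E]
  {H : Type*} [TopologicalSpace H] {I : ModelWithCorners ℝ E H}
  {G : Type*} [TopologicalSpace G] [ChartedSpace H G] [Group G]

variable (I) in
/-- `γ` is the one-parameter subgroup of `G` with initial velocity `w`. -/
structure IsOneParameterSubgroup (γ : ℝ → G) (w : E) : Prop where
  apply_add : ∀ s t, γ (s + t) = γ s * γ t
  hasVelocityAt_zero : HasVelocityAt I γ w 0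

theorem mulInvariantVectorField_one (w : GroupLieAlgebra I G) :
    mulInvariantVectorField w (1 : G) = w := by
  have hid :=
    ((hasMFDerivAt_id (I := I) (1 : G)).congr_of_eventuallyEq (.of_forall one_mul)).mfderiv
  exact DFunLike.congr_fun hid w

variable [LieGroup I ∞ G]

theorem mulInvariantVectorField_mul (w : GroupLieAlgebra I G) (g h : G) :
    mulInvariantVectorField w (g * h) =
      mfderiv I I (fun x => g * x) h (mulInvariantVectorField w h) := by
  have hleft (a b : G) : MDifferentiableAt I I (fun x => a * x) b :=
    contMDiff_mul_left.mdifferentiable (n := ∞) (by simp) b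
  have hleft' : HasMFDerivAt I I (fun x => g * x) (h * 1)
      (mfderiv I I (fun x => g * x) h : E →L[ℝ] E) := by
    rw [mul_one]
    exact (hleft g h).hasMFDerivAt
  have hcomp := (hleft'.comp 1 (hleft h 1).hasMFDerivAt).congr_of_eventuallyEq
    (.of_forall fun x => mul_assoc g h x)
  exact DFunLike.congr_fun hcomp.mfderiv w

theorem isMIntegralCurveOn_mul_left {γ : ℝ → G} {w : GroupLieAlgebra I G} {s : Set ℝ}
    (hγ : IsMIntegralCurveOn (I := I) γ (mulInvariantVectorField w) s) (g : G) :
    IsMIntegralCurveOn (I := I) (fun t => g * γ t) (mulInvariantVectorField w) s := by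
  intro t ht
  have hleft : MDifferentiableAt I I (fun x => g * x) (γ t) :=
    contMDiff_mul_left.mdifferentiable (n := ∞) (by simp) (γ t)
  refine (hleft.hasMFDerivAt.comp_hasMFDerivWithinAt t (hγ t ht)).congr_mfderiv ?_
  rw [mulInvariantVectorField_mul]
  exact ContinuousLinearMap.ext fun r : ℝ => map_smul (mfderiv I I (fun x => g * x) (γ t)) r _

variable [CompleteSpace E] [BoundarylessManifold I G] [T2Space G]

theorem exists_isMIntegralCurve_mulInvariantVectorField (w : GroupLieAlgebra I G) :
    ∃ γ : ℝ → G, γ 0 = 1 ∧ IsMIntegralCurve (I := I) γ (mulInvariantVectorField w) := by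
  have hw : ContMDiff I I.tangent 1
      fun g : G => (⟨g, mulInvariantVectorField w g⟩ : TangentBundle I G) :=
    (contMDiff_mulInvariantVectorField w).of_le (by simp)
  obtain ⟨γ, hγ0, hγ⟩ := exists_isMIntegralCurveAt_of_contMDiffAt_boundaryless 0 (hw 1)
  obtain ⟨ε, hε, hγ⟩ := isMIntegralCurveAt_iff'.1 hγ
  rw [Real.ball_eq_Ioo, zero_sub, zero_add] at hγ
  refine exists_isMIntegralCurve_of_isMIntegralCurveOn hw hε
    (fun g => ⟨fun t => g * γ t, ?_, isMIntegralCurveOn_mul_left hγ g⟩) 1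
  simp only [hγ0, mul_one]

variable (I G) in
theorem exists_isOneParameterSubgroup (w : E) :
    ∃ γ : ℝ → G, IsOneParameterSubgroup I γ w := by
  obtain ⟨γ, hγ0, hγ⟩ := exists_isMIntegralCurve_mulInvariantVectorField (I := I) (G := G) w
  have hw : ContMDiff I I.tangent 1
      fun g : G => (⟨g, mulInvariantVectorField (I := I) w g⟩ : TangentBundle I G) :=
    (contMDiff_mulInvariantVectorField _).of_le (by simp)
  refine ⟨γ, fun s t => ?_, ?_⟩
  · have hmul : IsMIntegralCurve (I := I) (fun t => γ s * γ t) (mulInvariantVectorField w) :=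
      isMIntegralCurve_iff_isMIntegralCurveOn.2
        (isMIntegralCurveOn_mul_left (hγ.isMIntegralCurveOn univ) (γ s))
    have heq := isMIntegralCurve_Ioo_eq_of_contMDiff_boundaryless (t₀ := 0) hw hmul
      (hγ.comp_add s) (by simp [hγ0])
    rw [add_comm]
    exact (congrFun heq t).symm
  · have hvel := isMIntegralCurve_iff_hasVelocityAt.1 hγ 0
    rw [hγ0] at hvel
    exact mulInvariantVectorField_one (I := I) (G := G) w ▸ hvel

end OneParameterSubgroup

section AdjointDeriv

variable {E : Type*} [NormedAddCommGroup E] [NormedSpace ℝ E]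
  {H : Type*} [TopologicalSpace H] {I : ModelWithCorners ℝ E H}
  {G : Type*} [TopologicalSpace G] [ChartedSpace H G] [Group G]

theorem IsOneParameterSubgroup.apply_zero {γ : ℝ → G} {w : E} (hγ : IsOneParameterSubgroup I γ w) :
    γ 0 = 1 := by
  simpa using hγ.apply_add 0 0

theorem IsOneParameterSubgroup.apply_sub_mul {γ : ℝ → G} {w : E}
    (hγ : IsOneParameterSubgroup I γ w) (s t : ℝ) : γ (s - t) * γ t = γ s := by
  rw [← hγ.apply_add, sub_add_cancel]

variable [LieGroup I ∞ G]

theorem HasVelocityAt.conj {γ : ℝ → G} {v : E} {t : ℝ} (hγ : HasVelocityAt I γ v t) (ht : γ t = 1)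
    (g : G) : HasVelocityAt I (fun s => g * γ s * g⁻¹) (adjointRep I G g v) t :=
  hγ.of_comp_mfderiv (mdifferentiableAt_conj g 1).hasMFDerivAt ht

variable [BoundarylessManifold I G] {γ : ℝ → G} {w : E}

theorem IsOneParameterSubgroup.hasDerivAt_adjointRep (hγ : IsOneParameterSubgroup I γ w)
    (u : E) (t : ℝ) : HasDerivAt (fun s => adjointRep I G (γ s) u)
      (adjointDeriv I G w (adjointRep I G (γ t) u)) t := by
  have hzero : HasDerivAt (fun s => adjointRep I G (γ s)) (adjointDeriv I G w) (t - t) := by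
    rw [sub_self]
    exact hasVelocityAt_iff_hasDerivAt.1
      (hγ.hasVelocityAt_zero.of_comp_mfderiv hasMFDerivAt_adjointRep_one hγ.apply_zero)
  have hshift := (hzero.comp_sub_const t t).clm_apply
    (hasDerivAt_const t (adjointRep I G (γ t) u))
  simp only [← mul_apply_eq_comp, ← map_mul, hγ.apply_sub_mul, map_zero, add_zero] at hshift
  exact hshift

section Skew

variable [CompleteSpace E] [T2Space G]

theorem adjointDeriv_self (w : E) : adjointDeriv I G w w = 0 := by
  obtain ⟨γ, hγ⟩ := exists_isOneParameterSubgroup I G w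
  have hconj (t s : ℝ) : γ t * γ s * (γ t)⁻¹ = γ s := by
    rw [mul_inv_eq_iff_eq_mul, ← hγ.apply_add, ← hγ.apply_add, add_comm]
  have hfix (t : ℝ) : adjointRep I G (γ t) w = w := by
    have h := hγ.hasVelocityAt_zero.conj hγ.apply_zero (γ t)
    simp only [hconj] at h
    exact h.unique hγ.hasVelocityAt_zero
  have hderiv := hγ.hasDerivAt_adjointRep w 0
  simp only [hfix] at hderiv
  exact hderiv.unique (hasDerivAt_const 0 w)

theorem adjointDeriv_swap (u v : E) : adjointDeriv I G u v = -adjointDeriv I G v u := by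
  have h := adjointDeriv_self (I := I) (G := G) (u + v)
  simp only [map_add, add_apply, adjointDeriv_self, zero_add, add_zero] at h
  exact eq_neg_of_add_eq_zero_right h

theorem adjointDeriv_skew_of_invariant [FiniteDimensional ℝ E] {B : LinearMap.BilinForm ℝ E}
    (hB : ∀ g u v, B (adjointRep I G g u) (adjointRep I G g v) = B u v) (w u v : E) :
    B (adjointDeriv I G w u) v = -B u (adjointDeriv I G w v) := by
  obtain ⟨γ, hγ⟩ := exists_isOneParameterSubgroup I G w
  have hderiv := B.toContinuousBilinearMap.hasDerivAt_of_bilinear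
    (fun _ => hγ.hasDerivAt_adjointRep u 0) (fun _ => hγ.hasDerivAt_adjointRep v 0)
  simp only [LinearMap.toContinuousBilinearMap_apply, hB, hγ.apply_zero, map_one,
    one_apply_eq_self] at hderiv
  exact eq_neg_of_add_eq_zero_right (hderiv.unique (hasDerivAt_const 0 (B u v)))

end Skew

end AdjointDeriv

section ChartField

variable {E : Type*} [NormedAddCommGroup E] [NormedSpace ℝ E]
  {H : Type*} [TopologicalSpace H] (I : ModelWithCorners ℝ E H)
  {M : Type*} [TopologicalSpace M] [ChartedSpace H M]

/-- The expression of a vector field in the preferred chart at `p`. -/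
noncomputable def chartField (p : M) (V : (x : M) → TangentSpace I x) (y : E) : E :=
  mfderiv I 𝓘(ℝ, E) (extChartAt I p) ((extChartAt I p).symm y) (V ((extChartAt I p).symm y))

variable {I} {p : M} {V W : (x : M) → TangentSpace I x}

theorem chartField_self [IsManifold I 1 M] : chartField I p V (extChartAt I p p) = V p := by
  rw [chartField, extChartAt_to_inv]
  exact DFunLike.congr_fun (hasMFDerivAt_extChartAt_self p).mfderiv (V p)

variable [BoundarylessManifold I M]

theorem mpullbackWithin_eventuallyEq_chartField [IsManifold I 1 M] :
    VectorField.mpullbackWithin 𝓘(ℝ, E) I (extChartAt I p).symm V (range I)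
      =ᶠ[𝓝 (extChartAt I p p)] chartField I p V := by
  filter_upwards [extChartAt_target_mem_nhds_self I p] with y hy
  rw [VectorField.mpullbackWithin_apply, chartField]
  congr 1
  exact ContinuousLinearMap.inverse_eq
    (mfderivWithin_extChartAt_symm_comp_mfderiv_extChartAt hy)
    (mfderiv_extChartAt_comp_mfderivWithin_extChartAt_symm hy)

theorem differentiableAt_chartField [CompleteSpace E] [IsManifold I 2 M]
    (hV : MDifferentiableAt I I.tangent (fun x => (⟨x, V x⟩ : TangentBundle I M)) p) :
    DifferentiableAt ℝ (chartField I p V) (extChartAt I p p) := by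
  have : IsManifold I 1 M := .of_le (n := 2) (by simp)
  have h := (hV.mdifferentiableWithinAt
    (s := univ)).differentiableWithinAt_mpullbackWithin_vectorField
  rw [preimage_univ, univ_inter] at h
  exact (h.differentiableAt (mem_of_superset (extChartAt_target_mem_nhds_self I p)
    (extChartAt_target_subset_range p))).congr_of_eventuallyEq
    mpullbackWithin_eventuallyEq_chartField.symm

theorem mlieBracket_eq_neg_fderiv_chartField [IsManifold I 1 M] (hV : V p = 0) :
    VectorField.mlieBracket I V W p = -fderiv ℝ (chartField I p V) (extChartAt I p p) (W p) := by
  have hrange : range I ∈ 𝓝 (extChartAt I p p) :=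
    mem_of_superset (extChartAt_target_mem_nhds_self I p) (extChartAt_target_subset_range p)
  have hchart : (mfderiv I 𝓘(ℝ, E) (extChartAt I p) p).inverse = ContinuousLinearMap.id ℝ E := by
    rw [mfderiv_extChartAt_self]
    exact ContinuousLinearMap.inverse_id
  have hbracket : VectorField.lieBracketWithin ℝ
      (VectorField.mpullbackWithin 𝓘(ℝ, E) I (extChartAt I p).symm V (range I))
      (VectorField.mpullbackWithin 𝓘(ℝ, E) I (extChartAt I p).symm W (range I))
      ((extChartAt I p).symm ⁻¹' univ ∩ range I) (extChartAt I p p) =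
      -fderiv ℝ (chartField I p V) (extChartAt I p p) (W p) := by
    rw [preimage_univ, univ_inter]
    refine (VectorField.lieBracketWithin_of_mem_nhds hrange).trans ?_
    refine (mpullbackWithin_eventuallyEq_chartField.lieBracket_vectorField_eq
      mpullbackWithin_eventuallyEq_chartField).trans ?_
    rw [VectorField.lieBracket, chartField_self, chartField_self, hV]
    exact (congrArg (· - _) (map_zero _)).trans (zero_sub _)
  change (mfderiv I 𝓘(ℝ, E) (extChartAt I p) p).inverse _ = _
  rw [hchart]
  exact hbracket

end ChartField

section RightLogDeriv

variable {E : Type*} [NormedAddCommGroup E] [NormedSpace ℝ E]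
  {H : Type*} [TopologicalSpace H] (I : ModelWithCorners ℝ E H)
  {G : Type*} [TopologicalSpace G] [ChartedSpace H G] [Group G]

/-- The vector field `X` in the right trivialization of the tangent bundle: the value of `X` at
`g` is moved to the identity by right translation. -/
noncomputable def rightLogDeriv (X : (g : G) → TangentSpace I g) (g : G) : E :=
  mfderiv I I (fun h => h * g⁻¹) g (X g)

variable (G) in
/-- The map `(h, g) ↦ h * g⁻¹` in the preferred chart at the identity. -/
noncomputable def chartDiv (z : E × E) : E :=
  extChartAt I (1 : G)
    ((extChartAt I (1 : G)).symm z.1 * ((extChartAt I (1 : G)).symm z.2)⁻¹)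

variable [LieGroup I ∞ G]

variable {I} {X : (g : G) → TangentSpace I g}

theorem mdifferentiableAt_mul_inv_const (h g : G) :
    MDifferentiableAt I I (fun x => x * g⁻¹) h :=
  contMDiff_mul_right.mdifferentiable (n := ∞) (by simp) h

theorem rightLogDeriv_extChartAt_symm {x : E} (hx : x ∈ (extChartAt I (1 : G)).target)
    (hdiv : DifferentiableAt ℝ (chartDiv I G) (x, x)) :
    rightLogDeriv I X ((extChartAt I (1 : G)).symm x) =
      fderiv ℝ (chartDiv I G) (x, x) (chartField I 1 X x, 0) := by
  let g : G := (extChartAt I (1 : G)).symm x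
  have hright : HasMFDerivAt I 𝓘(ℝ, E) (fun h => extChartAt I (1 : G) (h * g⁻¹)) g
      (mfderiv I I (fun h => h * g⁻¹) g : E →L[ℝ] E) := by
    have hchart : HasMFDerivAt I 𝓘(ℝ, E) (extChartAt I (1 : G)) (g * g⁻¹)
        (ContinuousLinearMap.id ℝ E) := by
      rw [mul_inv_cancel]
      exact hasMFDerivAt_extChartAt_self 1
    exact hchart.comp g (mdifferentiableAt_mul_inv_const g g).hasMFDerivAt
  have hslice : HasFDerivAt (fun y => chartDiv I G (y, x))
      (fderiv ℝ (chartDiv I G) (x, x) ∘L ContinuousLinearMap.inl ℝ E E) x :=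
    hdiv.hasFDerivAt.comp (f := fun y => (y, x)) x (hasFDerivAt_prodMk_left x x)
  exact DFunLike.congr_fun
    (hasMFDerivAt_unique hright (hasMFDerivAt_of_comp_extChartAt_symm hx hslice)) (X g)

variable [BoundarylessManifold I G]

variable (I G) in
theorem contDiffAt_chartDiv :
    ContDiffAt ℝ ∞ (chartDiv I G) (extChartAt I (1 : G) 1, extChartAt I (1 : G) 1) :=
  contDiffAt_extChartAt_comp_prodMap_symm (f := fun p : G × G => p.1 * p.2⁻¹)
    (contMDiff_fst.mul contMDiff_snd.inv).contMDiffAt (by simp)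

variable (I G) in
theorem fderiv_chartDiv_apply_inl (v : E) :
    fderiv ℝ (chartDiv I G) (extChartAt I (1 : G) 1, extChartAt I (1 : G) 1) (v, 0) = v := by
  have hslice : HasFDerivAt (fun y => chartDiv I G (y, extChartAt I (1 : G) 1)) _
      (extChartAt I (1 : G) 1) :=
    ((contDiffAt_chartDiv I G).differentiableAt (by simp)).hasFDerivAt.comp
      (f := fun y => (y, extChartAt I (1 : G) 1)) _ (hasFDerivAt_prodMk_left _ _)
  have hid : (fun y => chartDiv I G (y, extChartAt I (1 : G) 1))
      =ᶠ[𝓝 (extChartAt I (1 : G) 1)] id := by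
    filter_upwards [extChartAt_target_mem_nhds_self I (1 : G)] with y hy
    rw [chartDiv, extChartAt_to_inv, inv_one, mul_one, (extChartAt I (1 : G)).right_inv hy, id]
  exact DFunLike.congr_fun (hslice.unique ((hasFDerivAt_id _).congr_of_eventuallyEq hid)) v

theorem hasMFDerivAt_rightLogDeriv_one [CompleteSpace E]
    (hX : MDifferentiableAt I I.tangent (fun g => (⟨g, X g⟩ : TangentBundle I G)) 1)
    (hX1 : X 1 = 0) :
    HasMFDerivAt I 𝓘(ℝ, E) (rightLogDeriv I X) 1
      (fderiv ℝ (chartField I 1 X) (extChartAt I (1 : G) 1) : E →L[ℝ] E) := by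
  have : IsManifold I 2 G := .of_le (n := ∞) (by norm_cast)
  let o : E := extChartAt I (1 : G) 1
  have hdiv := contDiffAt_chartDiv I G
  have hdiag : ContDiffAt ℝ 1 (fun x : E => (x, x)) o := contDiffAt_id.prodMk contDiffAt_id
  have heq : ∀ᶠ x in 𝓝 o, (rightLogDeriv I X ∘ (extChartAt I (1 : G)).symm) x =
      fderiv ℝ (chartDiv I G) (x, x) (chartField I 1 X x, 0) := by
    have hev : ∀ᶠ z in 𝓝 (o, o), ContDiffAt ℝ 1 (chartDiv I G) z :=
      (hdiv.of_le (by simp)).eventually (by norm_num)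
    filter_upwards [hdiag.continuousAt.eventually hev, extChartAt_target_mem_nhds_self I (1 : G)]
      with x hx hxt
    exact rightLogDeriv_extChartAt_symm hxt (hx.differentiableAt one_ne_zero)
  have hfderiv : DifferentiableAt ℝ (fun x => fderiv ℝ (chartDiv I G) (x, x)) o :=
    (ContDiffAt.comp (f := fun x => (x, x)) o (hdiv.fderiv_right (m := 1) (by norm_cast))
      hdiag).differentiableAt one_ne_zero
  have hfield : HasFDerivAt (chartField I 1 X) (fderiv ℝ (chartField I 1 X) o : E →L[ℝ] E) o :=
    (differentiableAt_chartField hX).hasFDerivAt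
  have hprod := hfderiv.hasFDerivAt.clm_apply (hfield.prodMk (hasFDerivAt_const (0 : E) o))
  refine hasMFDerivAt_of_comp_extChartAt_symm_self
    ((hprod.congr_of_eventuallyEq heq).congr_fderiv (ContinuousLinearMap.ext fun v => ?_))
  have hfield_one : chartField I 1 X o = 0 := chartField_self.trans hX1
  simp only [ContinuousLinearMap.comp_apply, ContinuousLinearMap.prod_apply, zero_apply,
    hfield_one, Prod.mk_zero_zero, map_zero, add_zero]
  exact fderiv_chartDiv_apply_inl I G _

end RightLogDeriv

section LinearVectorField

variable {E : Type*} [NormedAddCommGroup E] [NormedSpace ℝ E]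
  {H : Type*} [TopologicalSpace H] {I : ModelWithCorners ℝ E H}
  {G : Type*} [TopologicalSpace G] [ChartedSpace H G]
  {X : (g : G) → TangentSpace I g} {φ : ℝ → G → G}

theorem IsFlowOf.hasVelocityAt_zero (hφ : IsFlowOf I X φ) (g : G) :
    HasVelocityAt I (fun t => φ t g) (X g) 0 := by
  have h := isMIntegralCurve_iff_hasVelocityAt.1 (hφ.isMIntegralCurve g) 0
  rwa [hφ.zero_apply] at h

variable [Group G] [LieGroup I ∞ G]

theorem IsLinearVectorField.exists_isFlowOf_mul (hX : IsLinearVectorField I X) :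
    ∃ φ : ℝ → G → G, IsFlowOf I X φ ∧ ∀ t g h, φ t (g * h) = φ t g * φ t h := by
  obtain ⟨φ, hφ, hauto⟩ := hX.exists_flow
  refine ⟨φ, hφ, fun t g h => ?_⟩
  obtain ⟨e, he, -⟩ := hauto t
  rw [← he, ← he, ← he, map_mul]

theorem IsFlowOf.hasVelocityAt_mul_inv (hφ : IsFlowOf I X φ) (g : G) :
    HasVelocityAt I (fun t => φ t g * g⁻¹) (rightLogDeriv I X g) 0 :=
  (hφ.hasVelocityAt_zero g).of_comp_mfderiv (mdifferentiableAt_mul_inv_const g g).hasMFDerivAt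
    (hφ.zero_apply g)

theorem HasVelocityAt.mul_of_eq_one {γ δ : ℝ → G} {v w : E} {t : ℝ} (hγ : HasVelocityAt I γ v t)
    (hδ : HasVelocityAt I δ w t) (hγt : γ t = 1) (hδt : δ t = 1) :
    HasVelocityAt I (fun s => γ s * δ s) (v + w) t := by
  have : LieGroup I 1 G := .of_le (n := ∞) (by simp)
  have h : (1 : ℝ →L[ℝ] ℝ).smulRight v + (1 : ℝ →L[ℝ] ℝ).smulRight w =
      (1 : ℝ →L[ℝ] ℝ).smulRight (v + w) := by ext; simp
  exact (hasMFDerivAt_mul_of_eq_one hγ hδ hγt hδt).congr_mfderiv h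

theorem IsLinearVectorField.rightLogDeriv_mul (hX : IsLinearVectorField I X) (g h : G) :
    rightLogDeriv I X (g * h) = rightLogDeriv I X g + adjointRep I G g (rightLogDeriv I X h) := by
  obtain ⟨φ, hφ, hmul⟩ := hX.exists_isFlowOf_mul
  have hone (k : G) : φ 0 k * k⁻¹ = 1 := by rw [hφ.zero_apply, mul_inv_cancel]
  have hprod := (hφ.hasVelocityAt_mul_inv g).mul_of_eq_one
    ((hφ.hasVelocityAt_mul_inv h).conj (hone h) g) (hone g) (by rw [hone]; group)
  have hcurve : (fun t => φ t (g * h) * (g * h)⁻¹) =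
      fun t => φ t g * g⁻¹ * (g * (φ t h * h⁻¹) * g⁻¹) := by
    funext t
    rw [hmul]
    group
  exact (hcurve ▸ hφ.hasVelocityAt_mul_inv (g * h)).unique hprod

theorem IsLinearVectorField.apply_one (hX : IsLinearVectorField I X) : X 1 = 0 := by
  obtain ⟨φ, hφ, hmul⟩ := hX.exists_isFlowOf_mul
  have hconst (t : ℝ) : φ t 1 = 1 := by simpa using hmul t 1 1
  have hvel := hφ.hasVelocityAt_zero 1
  simp only [hconst] at hvel
  exact hvel.unique (hasVelocityAt_const 1 0)

variable [CompleteSpace E] [BoundarylessManifold I G]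

theorem IsLinearVectorField.hasMFDerivAt_rightLogDeriv_one (hX : IsLinearVectorField I X) :
    HasMFDerivAt I 𝓘(ℝ, E) (rightLogDeriv I X) 1
      (fderiv ℝ (chartField I 1 X) (extChartAt I (1 : G) 1) : E →L[ℝ] E) :=
  LinearFlow.hasMFDerivAt_rightLogDeriv_one (hX.contMDiff.mdifferentiable (by simp) 1) hX.apply_one

theorem IsLinearVectorField.continuous_rightLogDeriv (hX : IsLinearVectorField I X) :
    Continuous (rightLogDeriv I X) := by
  have : IsTopologicalGroup G := topologicalGroup_of_lieGroup I ∞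
  exact continuous_of_cocycle hX.hasMFDerivAt_rightLogDeriv_one.continuousAt hX.rightLogDeriv_mul

theorem IsLinearVectorField.exists_rightLogDeriv_eq_sub [CompactSpace G]
    (hX : IsLinearVectorField I X) :
    ∃ w : E, ∀ g, rightLogDeriv I X g = w - adjointRep I G g w := by
  have : IsTopologicalGroup G := topologicalGroup_of_lieGroup I ∞
  exact exists_eq_sub_of_cocycle hX.continuous_rightLogDeriv hX.rightLogDeriv_mul

theorem IsLinearVectorField.derivationOf_apply_eq_fderiv (hX : IsLinearVectorField I X)
    (Y : GroupLieAlgebra I G) :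
    derivationOf I X Y = fderiv ℝ (chartField I 1 X) (extChartAt I (1 : G) 1) Y := by
  have : IsManifold I 1 G := .of_le (n := ∞) (by simp)
  change -VectorField.mlieBracket I X (mulInvariantVectorField Y) (1 : G) = _
  rw [mlieBracket_eq_neg_fderiv_chartField hX.apply_one, mulInvariantVectorField_one]
  exact neg_neg _

theorem IsLinearVectorField.derivationOf_apply_eq_adjointDeriv [T2Space G]
    (hX : IsLinearVectorField I X) {w : E}
    (hw : ∀ g, rightLogDeriv I X g = w - adjointRep I G g w) (Y : GroupLieAlgebra I G) :
    derivationOf I X Y = adjointDeriv I G w Y := by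
  have hadj : HasMFDerivAt I 𝓘(ℝ, E) (fun g => w - adjointRep I G g w) 1
      (-(adjointDeriv I G : E →L[ℝ] E →L[ℝ] E).flip w) := by
    have heval : HasFDerivAt (fun A : E →L[ℝ] E => w - A w) (-ContinuousLinearMap.apply ℝ E w)
        (adjointRep I G 1) := (ContinuousLinearMap.apply ℝ E w).hasFDerivAt.const_sub w
    exact heval.hasMFDerivAt.comp 1 hasMFDerivAt_adjointRep_one
  have hder := hasMFDerivAt_unique (hX.hasMFDerivAt_rightLogDeriv_one.congr_of_eventuallyEq
    (.of_forall fun g => (hw g).symm)) hadj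
  exact (hX.derivationOf_apply_eq_fderiv Y).trans
    ((DFunLike.congr_fun hder Y).trans (adjointDeriv_swap w Y).symm)

end LinearVectorField

section FlowEqConj

variable {E : Type*} [NormedAddCommGroup E] [NormedSpace ℝ E]
  {H : Type*} [TopologicalSpace H] {I : ModelWithCorners ℝ E H}
  {G : Type*} [TopologicalSpace G] [ChartedSpace H G] [Group G] [LieGroup I ∞ G]
  {X : (g : G) → TangentSpace I g} {φ : ℝ → G → G} {γ : ℝ → G} {w : E}

theorem HasVelocityAt.inv_of_eq_one {v : E} {t : ℝ} (hγ : HasVelocityAt I γ v t) (ht : γ t = 1) :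
    HasVelocityAt I (fun s => (γ s)⁻¹) (-v) t := by
  have : LieGroup I 1 G := .of_le (n := ∞) (by simp)
  have h : -(1 : ℝ →L[ℝ] ℝ).smulRight v = (1 : ℝ →L[ℝ] ℝ).smulRight (-v) := by ext; simp
  exact (hasMFDerivAt_inv_of_eq_one hγ ht).congr_mfderiv h

theorem mfderiv_mul_right_rightLogDeriv (g : G) :
    mfderiv I I (fun h => h * g) 1 (rightLogDeriv I X g : E) = X g := by
  have hright : HasMFDerivAt I I (fun h => h * g) (g * g⁻¹)
      (mfderiv I I (fun h => h * g) 1 : E →L[ℝ] E) := by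
    rw [mul_inv_cancel]
    exact (contMDiff_mul_right.mdifferentiable (n := ∞) (by simp) 1).hasMFDerivAt
  have hcomp := hright.comp g (mdifferentiableAt_mul_inv_const g g).hasMFDerivAt
  have hid := hcomp.congr_of_eventuallyEq (.of_forall fun h => (inv_mul_cancel_right h g).symm)
  exact DFunLike.congr_fun (hasMFDerivAt_unique hid (hasMFDerivAt_id g)) (X g)

theorem IsOneParameterSubgroup.hasVelocityAt_conj (hγ : IsOneParameterSubgroup I γ w)
    (hw : ∀ g, rightLogDeriv I X g = w - adjointRep I G g w) (g : G) :
    HasVelocityAt I (fun t => γ t * g * (γ t)⁻¹) (X g) 0 := by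
  have hγ0 := hγ.apply_zero
  have hcomm : HasVelocityAt I (fun t => γ t * (g * (γ t)⁻¹ * g⁻¹)) (rightLogDeriv I X g) 0 := by
    rw [hw, sub_eq_add_neg, ← map_neg]
    exact hγ.hasVelocityAt_zero.mul_of_eq_one
      ((hγ.hasVelocityAt_zero.inv_of_eq_one hγ0).conj (by simp [hγ0]) g) hγ0 (by simp [hγ0])
  have hright : HasMFDerivAt I I (fun h => h * g) 1 (mfderiv I I (fun h => h * g) 1 : E →L[ℝ] E) :=
    (contMDiff_mul_right.mdifferentiable (n := ∞) (by simp) 1).hasMFDerivAt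
  have hcurve : (fun t => γ t * g * (γ t)⁻¹) = fun t => γ t * (g * (γ t)⁻¹ * g⁻¹) * g := by
    funext t
    group
  rw [hcurve]
  exact mfderiv_mul_right_rightLogDeriv (X := X) g ▸ hcomm.of_comp_mfderiv hright (by simp [hγ0])

theorem IsOneParameterSubgroup.isFlowOf_conj (hγ : IsOneParameterSubgroup I γ w)
    (hw : ∀ g, rightLogDeriv I X g = w - adjointRep I G g w) :
    IsFlowOf I X fun t g => γ t * g * (γ t)⁻¹ where
  zero_apply g := by simp [hγ.apply_zero]
  isMIntegralCurve g := isMIntegralCurve_iff_hasVelocityAt.2 fun t => by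
    have hvel := hγ.hasVelocityAt_conj hw (γ t * g * (γ t)⁻¹)
    rw [← add_neg_cancel t] at hvel
    have hcurve : (fun s => γ (s + -t) * (γ t * g * (γ t)⁻¹) * (γ (s + -t))⁻¹) =
        fun s => γ s * g * (γ s)⁻¹ := by
      funext s
      rw [← hγ.apply_sub_mul s t, sub_eq_add_neg]
      group
    exact hcurve ▸ hvel.comp_add_const (-t)

variable [BoundarylessManifold I G] [T2Space G]

theorem IsFlowOf.eq (hX : ContMDiff I I.tangent 1 fun g => (⟨g, X g⟩ : TangentBundle I G))
    {ψ : ℝ → G → G} (hφ : IsFlowOf I X φ) (hψ : IsFlowOf I X ψ) : φ = ψ := by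
  funext t g
  exact congrFun (isMIntegralCurve_Ioo_eq_of_contMDiff_boundaryless (t₀ := 0) hX
    (hφ.isMIntegralCurve g) (hψ.isMIntegralCurve g) (by rw [hφ.zero_apply, hψ.zero_apply])) t

end FlowEqConj

section Constant

variable {E : Type*} [NormedAddCommGroup E] [NormedSpace ℝ E]
  {H : Type*} [TopologicalSpace H] {I : ModelWithCorners ℝ E H}
  {M : Type*} [TopologicalSpace M] [ChartedSpace H M] [BoundarylessManifold I M] [IsManifold I 1 M]
  {E' : Type*} [NormedAddCommGroup E'] [NormedSpace ℝ E']
  {H' : Type*} [TopologicalSpace H'] {J : ModelWithCorners ℝ E' H'}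
  {N : Type*} [TopologicalSpace N] [ChartedSpace H' N] [IsManifold J 1 N] {f : M → N}

theorem isLocallyConstant_of_hasMFDerivAt_zero
    (hf : ∀ x, HasMFDerivAt I J f x (0 : E →L[ℝ] E')) : IsLocallyConstant f := by
  refine (IsLocallyConstant.iff_eventually_eq f).2 fun p => ?_
  let e := extChartAt I p
  let e' := extChartAt J (f p)
  have hfp : ContinuousAt f p := (hf p).continuousAt
  have hsource : ∀ᶠ x in 𝓝 p, f x ∈ e'.source :=
    hfp.eventually (extChartAt_source_mem_nhds (I := J) (f p))
  have hderiv : ∀ᶠ y in 𝓝 (e p), HasFDerivAt (fun y => e' (f (e.symm y))) (0 : E →L[ℝ] E') y := by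
    have htendsto : Tendsto e.symm (𝓝 (e p)) (𝓝 p) := by
      simpa [e] using (contMDiffAt_extChartAt_symm_self I (n := 1) p).continuousAt.tendsto
    filter_upwards [eventually_eventually_nhds.2 (extChartAt_target_mem_nhds_self I p),
      htendsto.eventually hsource] with y hy hys
    have hsymm := ((contMDiffOn_extChartAt_symm (n := 1) p).contMDiffAt hy).mdifferentiableAt
      one_ne_zero
    have hchart := (mdifferentiableAt_extChartAt (I := J) (by simpa [e'] using hys)).hasMFDerivAt
    have hcomp := hchart.comp y
      ((hf (e.symm y)).comp y hsymm.hasMFDerivAt)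
    have hzero : HasMFDerivAt 𝓘(ℝ, E) 𝓘(ℝ, E') (fun y => e' (f (e.symm y))) y (0 : E →L[ℝ] E') :=
      hcomp.congr_mfderiv (ContinuousLinearMap.ext fun _ =>
        map_zero (mfderiv J 𝓘(ℝ, E') e' (f (e.symm y))))
    exact hasMFDerivAt_iff_hasFDerivAt.1 hzero
  obtain ⟨r, hr, hball⟩ := Metric.eventually_nhds_iff_ball.1 hderiv
  filter_upwards [hsource, extChartAt_source_mem_nhds (I := I) p,
    (continuousAt_extChartAt (I := I) p).eventually (Metric.ball_mem_nhds _ hr)] with x hx hxp hxr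
  refine e'.injOn hx (mem_extChartAt_source (f p)) ?_
  have hconst := (convex_ball (e p) r).is_const_of_fderivWithin_eq_zero (𝕜 := ℝ)
    (fun y hy => (hball y hy).differentiableAt.differentiableWithinAt)
    (fun y hy => (hball y hy).hasFDerivWithinAt.fderivWithin
      (Metric.isOpen_ball.uniqueDiffWithinAt hy)) hxr (Metric.mem_ball_self hr)
  simpa only [e, (extChartAt I p).left_inv hxp, extChartAt_to_inv] using hconst

theorem eq_of_hasMFDerivAt_zero [PreconnectedSpace M]
    (hf : ∀ x, HasMFDerivAt I J f x (0 : E →L[ℝ] E')) (x y : M) : f x = f y :=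
  (isLocallyConstant_of_hasMFDerivAt_zero hf).apply_eq_of_preconnectedSpace x y

end Constant

section Central

variable {E : Type*} [NormedAddCommGroup E] [NormedSpace ℝ E]
  {H : Type*} [TopologicalSpace H] {I : ModelWithCorners ℝ E H}
  {G : Type*} [TopologicalSpace G] [ChartedSpace H G] [Group G] [LieGroup I ∞ G]

theorem hasMFDerivAt_commutator_zero {a : G} (ha : adjointRep I G a = 1) (h : G) :
    HasMFDerivAt I I (fun x => a * x * a⁻¹ * x⁻¹) h (0 : E →L[ℝ] E) := by
  have : LieGroup I 1 G := .of_le (n := ∞) (by simp)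
  -- Right translation by `b⁻¹` makes the commutator a product of two maps sending `h` to `1`.
  let b := a * h * a⁻¹ * h⁻¹
  have hb : adjointRep I G b = 1 := by
    have hmem : a * (h * a⁻¹ * h⁻¹) ∈ (adjointRep I G).ker :=
      mul_mem ha (Subgroup.Normal.conj_mem inferInstance _ (inv_mem ha) h)
    simpa only [b, mul_assoc] using MonoidHom.mem_ker.1 hmem
  have hright := (mdifferentiableAt_mul_inv_const h h).hasMFDerivAt (I := I)
  have hone := mul_inv_cancel h
  have hconj := hasMFDerivAt_conj_of_eq_one a hright hone
  have hinv := hasMFDerivAt_conj_of_eq_one b (hasMFDerivAt_inv_of_eq_one hright hone) (by simp)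
  have hprod := hasMFDerivAt_mul_of_eq_one hconj hinv (by simp) (by simp)
  have hcancel (L : E →L[ℝ] E) : (1 : E →L[ℝ] E) ∘L L + 1 ∘L (-L) = 0 := by ext; simp
  have hzero : HasMFDerivAt I I (fun x => a * (x * h⁻¹) * a⁻¹ * (b * (x * h⁻¹)⁻¹ * b⁻¹)) h
      (0 : E →L[ℝ] E) := hprod.congr_mfderiv (by rw [ha, hb]; exact hcancel _)
  have hmul (k : G) : MDifferentiableAt I I (fun x => x * b) k :=
    contMDiff_mul_right.mdifferentiable (n := ∞) (by simp) k
  have hcurve : (fun x => a * x * a⁻¹ * x⁻¹) =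
      fun x => a * (x * h⁻¹) * a⁻¹ * (b * (x * h⁻¹)⁻¹ * b⁻¹) * b := by
    funext x
    simp only [b]
    group
  rw [hcurve]
  exact ((hmul _).hasMFDerivAt.comp h hzero).congr_mfderiv (ContinuousLinearMap.comp_zero _)

variable [BoundarylessManifold I G] [PreconnectedSpace G]

theorem conj_eq_self_of_adjointRep_eq_one {a : G} (ha : adjointRep I G a = 1) (g : G) :
    a * g * a⁻¹ = g := by
  have : IsManifold I 1 G := .of_le (n := ∞) (by simp)
  have hconst := eq_of_hasMFDerivAt_zero (hasMFDerivAt_commutator_zero ha) g 1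
  rwa [mul_one, mul_inv_cancel, one_mul, inv_one, mul_inv_eq_one] at hconst

end Central

section Periodicity

variable {E : Type*} [NormedAddCommGroup E] [NormedSpace ℝ E]
  {H : Type*} [TopologicalSpace H] {I : ModelWithCorners ℝ E H}
  {G : Type*} [TopologicalSpace G] [ChartedSpace H G] [Group G] [LieGroup I ∞ G]
  [BoundarylessManifold I G]

theorem IsOneParameterSubgroup.adjointRep_two_pi_div {γ : ℝ → G} {w : E} {β : ℝ}
    (hγ : IsOneParameterSubgroup I γ w) (hβ : β ≠ 0)
    (hcube : ∀ v, adjointDeriv I G w (adjointDeriv I G w (adjointDeriv I G w v)) =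
      -(β ^ 2) • adjointDeriv I G w v) :
    adjointRep I G (γ (2 * Real.pi / β)) = 1 := by
  ext v
  rw [eq_add_sin_smul_add_cos_smul hβ hcube (hγ.hasDerivAt_adjointRep v),
    mul_div_cancel₀ _ hβ, Real.sin_two_pi, Real.cos_two_pi, sub_self, zero_div, zero_div, zero_smul,
    zero_smul, add_zero, add_zero, hγ.apply_zero, map_one]

variable [FiniteDimensional ℝ E] [CompleteSpace E] [T2Space G] [CompactSpace G]

theorem exists_adjointDeriv_cube_eq_neg_sq_smul {w : E} {α : ℝ}
    (hα : ∀ μ : ℂ, IsComplexEigenvalue (adjointDeriv I G w : E →ₗ[ℝ] E) μ →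
      μ = 0 ∨ μ = α * Complex.I ∨ μ = -(α * Complex.I)) :
    ∃ β : ℝ, 0 < β ∧ ∀ v, adjointDeriv I G w (adjointDeriv I G w (adjointDeriv I G w v)) =
      -(β ^ 2) • adjointDeriv I G w v := by
  have : IsTopologicalGroup G := topologicalGroup_of_lieGroup I ∞
  obtain ⟨B, hsymm, hpos, hB⟩ := exists_invariant_bilinForm (ρ := adjointRep I G)
    fun v => continuous_adjointRep.clm_apply continuous_const
  exact exists_cube_eq_neg_sq_smul_of_skew hsymm hpos (adjointDeriv_skew_of_invariant hB w) hα

theorem IsLinearVectorField.exists_pos_flow_eq_self [PreconnectedSpace G]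
    {X : (g : G) → TangentSpace I g} {φ : ℝ → G → G} (hX : IsLinearVectorField I X)
    (hφ : IsFlowOf I X φ) {α : ℝ}
    (hα : ∀ μ : ℂ, IsComplexEigenvalue (derivationOf I X) μ →
      μ = 0 ∨ μ = α * Complex.I ∨ μ = -(α * Complex.I)) :
    ∃ T : ℝ, 0 < T ∧ ∀ g, φ T g = g := by
  obtain ⟨w, hw⟩ := hX.exists_rightLogDeriv_eq_sub
  have had : derivationOf I X = (adjointDeriv I G w : E →ₗ[ℝ] E) :=
    LinearMap.ext (hX.derivationOf_apply_eq_adjointDeriv hw)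
  rw [had] at hα
  obtain ⟨β, hβ, hcube⟩ :=
    exists_adjointDeriv_cube_eq_neg_sq_smul (E := E) (I := I) (G := G) hα
  obtain ⟨γ, hγ⟩ := exists_isOneParameterSubgroup I G w
  have hflow : φ = fun t g => γ t * g * (γ t)⁻¹ :=
    hφ.eq (hX.contMDiff.of_le (by simp)) (hγ.isFlowOf_conj hw)
  refine ⟨2 * Real.pi / β, by positivity, fun g => ?_⟩
  rw [hflow]
  exact conj_eq_self_of_adjointRep_eq_one (hγ.adjointRep_two_pi_div hβ.ne' hcube) g

end Periodicity

theorem image2_singleton_eq_range_of_periodic {M : Type*} {φ : ℝ → M → M} {g : M} {T : ℝ}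
    (hT : 0 < T) (hper : Function.Periodic (fun t => φ t g) T) {u : Set ℝ} (hu : u ∈ atTop) :
    image2 φ u {g} = range fun t => φ t g := by
  rw [image2_singleton_right]
  refine Subset.antisymm (image_subset_range _ _) ?_
  rintro _ ⟨t, rfl⟩
  obtain ⟨a, ha⟩ := mem_atTop_sets.1 hu
  obtain ⟨n, hn⟩ := exists_nat_gt ((a - t) / T)
  rw [div_lt_iff₀ hT] at hn
  exact ⟨t + n * T, ha _ (by linarith), hper.nat_mul n t⟩

theorem omegaLimit_eq_range_of_periodic {M : Type*} [TopologicalSpace M] [T2Space M]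
    {φ : ℝ → M → M} {g : M} {T : ℝ} (hT : 0 < T) (hcont : Continuous fun t => φ t g)
    (hper : Function.Periodic (fun t => φ t g) T) :
    omegaLimit atTop φ {g} = range fun t => φ t g := by
  have hclosed : IsClosed (range fun t => φ t g) := by
    rw [← hper.image_Icc hT 0]
    exact (isCompact_Icc.image hcont).isClosed
  have hclosure (u : Set ℝ) (hu : u ∈ atTop) :
      closure (image2 φ u {g}) = range fun t => φ t g := by
    rw [image2_singleton_eq_range_of_periodic hT hper hu, hclosed.closure_eq]
  rw [omegaLimit_def, iInter₂_congr hclosure]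
  exact biInter_const ⟨univ, univ_mem⟩ _

end LinearFlow

theorem mainTheorem5_general
    {E : Type*} [NormedAddCommGroup E] [NormedSpace ℝ E] [FiniteDimensional ℝ E] [CompleteSpace E]
    {H : Type*} [TopologicalSpace H] (I : ModelWithCorners ℝ E H)
    {G : Type*} [TopologicalSpace G] [ChartedSpace H G] [Group G] [LieGroup I ∞ G]
    [BoundarylessManifold I G] [T2Space G] [ConnectedSpace G] [CompactSpace G]
    (X : (g : G) → TangentSpace I g) (hX : LinearFlow.IsLinearVectorField I X)
    (φ : ℝ → G → G) (hφ : LinearFlow.IsFlowOf I X φ)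
    (α : ℝ)
    (hα : ∀ μ : ℂ, LinearFlow.IsComplexEigenvalue (LinearFlow.derivationOf I X) μ →
      μ = 0 ∨ μ = α * Complex.I ∨ μ = -(α * Complex.I))
    (g : G) (Ω : Set G) (hΩ : Ω = omegaLimit Filter.atTop φ {g})
    (hfix : ∀ x ∈ Ω, ¬ LinearFlow.IsFixedPoint φ x) :
    LinearFlow.IsPeriodicOrbit φ Ω := by
  have : IsManifold I 1 G := .of_le (n := ∞) (by simp)
  obtain ⟨T, hT, hid⟩ := hX.exists_pos_flow_eq_self hφ hα
  have hper : Function.Periodic (fun t => φ t g) T := by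
    have h := (hφ.isMIntegralCurve g).periodic_of_eq (a := T) (b := 0)
      (hX.contMDiff.of_le (by simp)) (by simp only [hid, hφ.zero_apply])
    rwa [sub_zero] at h
  have horbit : Ω = Set.range fun t => φ t g :=
    hΩ.trans (LinearFlow.omegaLimit_eq_range_of_periodic hT (hφ.isMIntegralCurve g).continuous hper)
  have hg : g ∈ Ω := horbit ▸ ⟨0, hφ.zero_apply g⟩
  exact ⟨g, hfix g hg, ⟨T, hT, hper⟩, horbit⟩

theorem mainTheorem5
    {E : Type*} [NormedAddCommGroup E] [NormedSpace ℝ E] [FiniteDimensional ℝ E] [CompleteSpace E]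
    {H : Type*} [TopologicalSpace H] (I : ModelWithCorners ℝ E H)
    {G : Type*} [TopologicalSpace G] [ChartedSpace H G] [Group G] [LieGroup I ∞ G]
    [BoundarylessManifold I G] [T2Space G] [ConnectedSpace G] [CompactSpace G]
    (hG : LinearFlow.IsSemisimpleLieGroup I G)
    (X : (g : G) → TangentSpace I g) (hX : LinearFlow.IsLinearVectorField I X)
    (φ : ℝ → G → G) (hφ : LinearFlow.IsFlowOf I X φ)
    (α : ℝ)
    (hα : ∀ μ : ℂ, LinearFlow.IsComplexEigenvalue (LinearFlow.derivationOf I X) μ →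
      μ = 0 ∨ μ = α * Complex.I ∨ μ = -(α * Complex.I))
    (g : G) (Ω : Set G) (hΩ : Ω = omegaLimit Filter.atTop φ {g})
    (hne : Ω.Nonempty) (hcpt : IsCompact Ω)
    (hfix : ∀ x ∈ Ω, ¬ LinearFlow.IsFixedPoint φ x) :
    LinearFlow.IsPeriodicOrbit φ Ω :=
  mainTheorem5_general I X hX φ hφ α hα g Ω hΩ hfix
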